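/- Let $n\ge 1$, $q\in\mathbb C$ with $0<|q|<1$, and let $\tau=(\tau_1,\dots,\tau_n)\in\mathbb C^n$ satisfy $0<|\tau_1|<|\tau_2|<\cdots<|\tau_n|<1$. For $\alpha\in\mathbb Z^n$ put $|\alpha|:=|\alpha_1|+\cdots+|\alpha_n|$. The degree of a Laurent polynomial $f=\sum_\alpha c_\alpha x^\alpha\in\mathbb C[x_1^{\pm1},\dots,x_n^{\pm1}]$ is $\deg f:=\max\{|\alpha| : c_\alpha\neq 0\}$, with $\deg 0:=-\infty$. For $J\subseteq\{1,\dots,n\}$ put $x_J:=\prod_{j\in J}x_j$, and put $\operatorname{sgn}(a):=1$ if $a\ge 0$, $\operatorname{sgn}(a):=-1$ if $a<0$. For $\alpha\in\mathbb Z^n$ let $\pi_\alpha\in S_n$ be the unique permutation such that, for all $i<j$, $$\pi_\alpha^{-1}(i)<\pi_\alpha^{-1}(j)\iff |\alpha_i|>|\alpha_j|\ \text{ or }\ 0\le\alpha_i=\pm\alpha_j,$$ and define the interpolation point $\overline\alpha\in(\mathbb C\setminus\{0\})^n$ by $$\overline\alpha_i:=q^{\alpha_i}\bigl(\tau_{\pi_\alpha^{-1}(i)}\bigr)^{\operatorname{sgn}(\alpha_i)}\qquad(1\le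 i\le n).$$ For $d\in\mathbb Z_{\ge0}$ and $I\subseteq\{1,\dots,n\}$ with complement $I^{\mathsf c}$ put $$\Lambda_{n,d}:=\{\alpha\in\mathbb Z^n : |\alpha|\le d\},$$ $$R(n,d,I):=\{\alpha\in\Lambda_{n,d} : \alpha_j\ne0 \text{ for all } j,\ \text{and } \alpha_i\neq-1 \text{ for } i\in I^{\mathsf c}\},$$ $$T(n,d,I):=\{\alpha\in\Lambda_{n,d} : \alpha_i\neq0 \text{ for } i\in I^{\mathsf c}\}.$$ Then, for every $d\in\mathbb Z_{\ge 0}$: (a) For every $I\subseteq\{1,\dots,n\}$ and every map $\overline f\colon R(n,d,I)\to\mathbb C$ there is a Laurent polynomial $f$ with $f(\overline\alpha)=\overline f(\alpha)$ for all $\alpha\in R(n,d,I)$ and $\deg(x_Jf)\le d-n+|I|$ for all $J\subseteq I$. (b) For every $I\subseteq\{1,\dots,n\}$ and every map $\overline f\colon T(n,d,I)\to\mathbb C$ there is a Laurent polynomial $f$ with $f(\overline\alpha)=\overline f(\alpha)$ for all $\alpha\in T(n,d,I)$ and $\deg(x_Jf)\le d$ for all $J\subseteq I^{\mathsf c}$.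 (c) For every map $\overline f\colon\Lambda_{n,d}\to\mathbb C$ there is a unique Laurent polynomial $f$ of degree $\le d$ such that $f(\overline\alpha)=\overline f(\alpha)$ for all $\alpha\in\Lambda_{n,d}$. (d) Consequently the nonsymmetric interpolation polynomials are well defined: for every $\alpha\in\mathbb Z^n$ there is a unique Laurent polynomial $G_\alpha$ of degree $\le|\alpha|$ with $G_\alpha(\overline\alpha)=1$ and $G_\alpha(\overline\beta)=0$ for all $\beta\in\mathbb Z^n$ with $|\beta|\le|\alpha|$, $\beta\ne\alpha$. -/

import Mathlib

namespace LaurentInterp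

/-- The `ℂ`-algebra `ℂ[x₁^{±1}, …, xₙ^{±1}]` of Laurent polynomials in `n` variables. -/
abbrev LaurentPoly (n : ℕ) : Type := AddMonoidAlgebra ℂ (Fin n → ℤ)

/-- The weight `|α| = |α₁| + ⋯ + |αₙ|`. -/
def weight {n : ℕ} (α : Fin n → ℤ) : ℤ := ∑ i, |α i|

/-- The degree of a Laurent polynomial: the largest weight of an exponent that occurs in it,
and `⊥` (that is, `-∞`) for the zero polynomial. -/
def degree {n : ℕ} (f : LaurentPoly n) : WithBot ℤ :=
  f.coeff.support.sup fun α => (weight α : WithBot ℤ)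

/-- The value of a Laurent polynomial at a point `x`, of interest when all `x i ≠ 0`. -/
noncomputable def eval {n : ℕ} (x : Fin n → ℂ) (f : LaurentPoly n) : ℂ :=
  f.coeff.sum fun α c => c * ∏ i, x i ^ α i

/-- The monomial `x_J = ∏_{j ∈ J} x_j`. -/
noncomputable def xProd {n : ℕ} (J : Finset (Fin n)) : LaurentPoly n :=
  AddMonoidAlgebra.single (fun i => if i ∈ J then 1 else 0) 1

/-- The sign, with the convention that the sign of `0` is `1`. -/
def sgn (a : ℤ) : ℤ := if 0 ≤ a then 1 else -1

/-- Sorting key for the positions of `α`: larger `|α i|` first; among positions with the same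
`|α i|` first those with `α i ≥ 0` in increasing order, then those with `α i < 0` in decreasing
order. -/
def sortKey {n : ℕ} (α : Fin n → ℤ) (i : Fin n) : ℤ ×ₗ ℤ :=
  toLex (-|α i|, if 0 ≤ α i then (i : ℤ) else 2 * (n : ℤ) - (i : ℤ))

/-- The permutation `π_α`, which lists the positions of `α` in the order of `sortKey`. So
`(|α_{π(1)}|, …, |α_{π(n)}|)` is the partition `α⁺`, and within a block of equal absolute values
`a` the positions with `α = a ≥ 0` come first, increasingly, followed by those with
`α = -a < 0`, decreasingly. -/
def sortPerm {n : ℕ} (α : Fin n → ℤ) : Equiv.Perm (Fin n) := Tuple.sort (sortKey α)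

theorem sortKey_lt_iff {n : ℕ} (α : Fin n → ℤ) {i j : Fin n} (hij : i < j) :
    sortKey α i < sortKey α j ↔
      (|α j| < |α i| ∨ (0 ≤ α i ∧ (α i = α j ∨ α i = -α j))) := by
  have hi := i.2
  have hj := j.2
  have hij' : (i : ℕ) < (j : ℕ) := hij
  unfold sortKey
  rw [Prod.Lex.toLex_lt_toLex]
  dsimp only
  split_ifs <;> grind

theorem sortKey_injective {n : ℕ} (α : Fin n → ℤ) : Function.Injective (sortKey α) := by
  intro i j h
  have hi := i.2
  have hj := j.2
  unfold sortKey at h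
  rw [toLex_inj, Prod.mk.injEq] at h
  apply Fin.ext
  have h2 := h.2
  split_ifs at h2 <;> omega

theorem sortPerm_symm_lt_iff_sortKey {n : ℕ} (α : Fin n → ℤ) (i j : Fin n) :
    (sortPerm α).symm i < (sortPerm α).symm j ↔ sortKey α i < sortKey α j := by
  have hm : StrictMono (sortKey α ∘ sortPerm α) :=
    (Tuple.monotone_sort (sortKey α)).strictMono_of_injective
      ((sortKey_injective α).comp (sortPerm α).injective)
  have := hm.lt_iff_lt (a := (sortPerm α).symm i) (b := (sortPerm α).symm j)
  simpa using this.symm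

/-- `π_α` is the unique permutation such that, for `i < j`, one has `π_α⁻¹(i) < π_α⁻¹(j)` if and
only if `|α i| > |α j|` or `0 ≤ α i = ± α j`. -/
theorem eq_sortPerm_iff {n : ℕ} (α : Fin n → ℤ) (π : Equiv.Perm (Fin n)) :
    π = sortPerm α ↔
      ∀ i j : Fin n, i < j → (π.symm i < π.symm j ↔
        (|α j| < |α i| ∨ (0 ≤ α i ∧ (α i = α j ∨ α i = -α j)))) := by
  constructor
  · rintro rfl i j hij
    rw [sortPerm_symm_lt_iff_sortKey, sortKey_lt_iff α hij]
  · intro h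
    have key : ∀ i j : Fin n, π.symm i < π.symm j ↔ sortKey α i < sortKey α j := by
      intro i j
      rcases lt_trichotomy i j with hij | rfl | hij
      · rw [h i j hij, sortKey_lt_iff α hij]
      · simp
      · have h1 := h j i hij
        rw [← sortKey_lt_iff α hij] at h1
        have hne : π.symm i ≠ π.symm j := fun e => hij.ne' (π.symm.injective e)
        have hne' : sortKey α i ≠ sortKey α j := fun e => hij.ne' (sortKey_injective α e)
        constructor
        · intro hl
          exact lt_of_le_of_ne (not_lt.1 fun c => lt_asymm hl (h1.2 c)) hne'
        · intro hl
          exact lt_of_le_of_ne (not_lt.1 fun c => lt_asymm hl (h1.1 c)) hne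
    have hm : Monotone (sortKey α ∘ π) := by
      apply StrictMono.monotone
      intro a b hab
      have := key (π a) (π b)
      simp only [Equiv.symm_apply_apply] at this
      exact this.1 hab
    have := Tuple.unique_monotone hm (Tuple.monotone_sort (sortKey α))
    ext a
    exact congrArg _ (sortKey_injective α (congrFun this a))

/-- The parameters `τ` with `0 < |τ₁| < |τ₂| < ⋯ < |τₙ| < 1`. -/
def paramSet (n : ℕ) : Set (Fin n → ℂ) :=
  {τ | (∀ i, 0 < ‖τ i‖) ∧ (∀ i j, i < j → ‖τ i‖ < ‖τ j‖) ∧ ∀ i, ‖τ i‖ < 1}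

/-- The interpolation point `ᾱ(q, τ)`, with
`ᾱ i = q ^ (α i) * (τ (π_α⁻¹ i)) ^ sgn (α i)`. -/
noncomputable def point {n : ℕ} (q : ℂ) (τ : Fin n → ℂ) (α : Fin n → ℤ) : Fin n → ℂ :=
  fun i => q ^ α i * τ ((sortPerm α).symm i) ^ sgn (α i)

/-- `Λ_{n,d}`: the `α ∈ ℤⁿ` of weight at most `d`. -/
def indexSet (n d : ℕ) : Set (Fin n → ℤ) := {α | weight α ≤ d}

/-- `R(n,d,I)`: the `α ∈ Λ_{n,d}` with `α j ≠ 0` for all `j`, and `α i ≠ -1` for `i ∉ I`. -/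
def indexSetR (n d : ℕ) (I : Finset (Fin n)) : Set (Fin n → ℤ) :=
  {α | α ∈ indexSet n d ∧ (∀ j, α j ≠ 0) ∧ ∀ i, i ∉ I → α i ≠ -1}

/-- `T(n,d,I)`: the `α ∈ Λ_{n,d}` with `α i ≠ 0` for `i ∉ I`. -/
def indexSetT (n d : ℕ) (I : Finset (Fin n)) : Set (Fin n → ℤ) :=
  {α | α ∈ indexSet n d ∧ ∀ i, i ∉ I → α i ≠ 0}

/-- `f` is a nonsymmetric interpolation Laurent polynomial `G_α( · ; q, τ)`: it has degree at
most `|α|`, takes the value `1` at `ᾱ`, and vanishes at `β̄` for every `β ≠ α` with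
`|β| ≤ |α|`. -/
def IsNonsymmetricInterp {n : ℕ} (q : ℂ) (τ : Fin n → ℂ) (α : Fin n → ℤ)
    (f : LaurentPoly n) : Prop :=
  degree f ≤ (weight α : WithBot ℤ) ∧ eval (point q τ α) f = 1 ∧
    ∀ β : Fin n → ℤ, weight β ≤ weight α → β ≠ α → eval (point q τ β) f = 0

end LaurentInterp

namespace LaurentInterp

/-! Existence is a Newton interpolation in which `R` and `T` feed each other, by induction on the
number of variables and then on `d`. All exponents of `R(n,d,∅)` avoid `0` and `-1`, so moving each
one step towards `0` while replacing `τ` by `qτ` leaves the points unchanged and reduces to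
`Λ_{n,d-n}` (`Interpolates.of_smul`). Also `R(n,d,univ) = T(n,d,∅)` and `T(n,d,univ) = Λ_{n,d}`, so
it remains to enlarge `I` by one index `k`.

For `R` the new points have `α k = -1`, for `T` they have `α k = 0`. If `I` grows downwards for `R`
and upwards for `T`, position `k` is sorted last at a new point: coordinate `k` is then a constant
depending only on `q` and `τₙ`, and the others form a point in one variable less. A binomial in
`x_k` vanishes at the new points and, by comparing norms, at none of the old ones, so
`Interpolates.newton_step` applies (`Interpolates.insert_min`, `Interpolates.insert_max`). The
bounds on all `x_J f` are what absorbs the degree of this binomial.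

Uniqueness is a dimension count: there are as many points as monomials of degree at most `d`. -/

variable {n : ℕ}

/-! ### Evaluation and supports -/

/-- The evaluation of Laurent polynomials at `x`, as a linear map. -/
noncomputable def evalLinear (x : Fin n → ℂ) : LaurentPoly n →ₗ[ℂ] ℂ :=
  (Finsupp.linearCombination ℂ fun α : Fin n → ℤ => ∏ i, x i ^ α i) ∘ₗ
    (AddMonoidAlgebra.coeffLinearEquiv ℂ).toLinearMap

theorem evalLinear_apply (x : Fin n → ℂ) (f : LaurentPoly n) : evalLinear x f = eval x f := by
  simp [evalLinear, eval, Finsupp.linearCombination_apply]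

theorem eval_add (x : Fin n → ℂ) (f g : LaurentPoly n) :
    eval x (f + g) = eval x f + eval x g := by
  simp only [← evalLinear_apply, map_add]

theorem eval_sub (x : Fin n → ℂ) (f g : LaurentPoly n) :
    eval x (f - g) = eval x f - eval x g := by
  simp only [← evalLinear_apply, map_sub]

theorem eval_single (x : Fin n → ℂ) (γ : Fin n → ℤ) (c : ℂ) :
    eval x (AddMonoidAlgebra.single γ c) = c * ∏ i, x i ^ γ i := by
  simp [eval]

theorem eval_single_mul {x : Fin n → ℂ} (hx : ∀ i, x i ≠ 0) (γ : Fin n → ℤ) (c : ℂ)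
    (f : LaurentPoly n) :
    eval x (AddMonoidAlgebra.single γ c * f) = c * (∏ i, x i ^ γ i) * eval x f := by
  induction f using AddMonoidAlgebra.induction_linear with
  | zero => simp [eval]
  | add f g hf hg => rw [mul_add, eval_add, eval_add, hf, hg, mul_add]
  | single m r =>
    rw [AddMonoidAlgebra.single_mul_single, eval_single, eval_single]
    simp only [Pi.add_apply, fun i => zpow_add₀ (hx i), Finset.prod_mul_distrib]
    ring

/-- The Laurent polynomials all of whose exponents lie in `S`. -/
noncomputable def supportedIn (S : Set (Fin n → ℤ)) : Submodule ℂ (LaurentPoly n) :=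
  (Finsupp.supported ℂ ℂ S).comap (AddMonoidAlgebra.coeffLinearEquiv ℂ).toLinearMap

theorem mem_supportedIn {S : Set (Fin n → ℤ)} {f : LaurentPoly n} :
    f ∈ supportedIn S ↔ ∀ β ∈ f.coeff.support, β ∈ S := by
  simp [supportedIn, Finsupp.mem_supported, Set.subset_def]

theorem supportedIn_mono {S T : Set (Fin n → ℤ)} (h : S ⊆ T) :
    supportedIn S ≤ supportedIn T := fun _ hf =>
  mem_supportedIn.2 fun β hβ => h (mem_supportedIn.1 hf β hβ)

theorem single_mem_supportedIn {S : Set (Fin n → ℤ)} {γ : Fin n → ℤ} (hγ : γ ∈ S) (c : ℂ) :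
    AddMonoidAlgebra.single γ c ∈ supportedIn S := by
  refine mem_supportedIn.2 fun β hβ => ?_
  rw [AddMonoidAlgebra.coeff_single] at hβ
  rwa [Finset.mem_singleton.1 (Finsupp.support_single_subset hβ)]

theorem single_mul_mem_supportedIn {S T : Set (Fin n → ℤ)} {γ : Fin n → ℤ}
    (h : ∀ β ∈ S, γ + β ∈ T) (c : ℂ) {f : LaurentPoly n} (hf : f ∈ supportedIn S) :
    AddMonoidAlgebra.single γ c * f ∈ supportedIn T := by
  classical
  refine mem_supportedIn.2 fun β hβ => ?_
  obtain ⟨β', hβ', rfl⟩ := Finset.mem_image.1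
    (AddMonoidAlgebra.support_coeff_single_mul_subset f c γ hβ)
  exact h _ (mem_supportedIn.1 hf _ hβ')

theorem degree_le_iff {D : ℤ} {f : LaurentPoly n} :
    degree f ≤ (D : WithBot ℤ) ↔ f ∈ supportedIn {β : Fin n → ℤ | weight β ≤ D} := by
  simp only [degree, Finset.sup_le_iff, mem_supportedIn, Set.mem_ofPred_eq, WithBot.coe_le_coe]

theorem weight_nonneg (α : Fin n → ℤ) : 0 ≤ weight α :=
  Finset.sum_nonneg fun _ _ => abs_nonneg _

theorem abs_le_weight (α : Fin n → ℤ) (i : Fin n) : |α i| ≤ weight α :=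
  Finset.single_le_sum (f := fun i => |α i|) (fun _ _ => abs_nonneg _) (Finset.mem_univ i)

/-! ### Simultaneous degree bounds on the products `x_J f` -/

/-- The exponent of the monomial `x_J`. -/
def indicator (J : Finset (Fin n)) : Fin n → ℤ := fun i => if i ∈ J then 1 else 0

/-- The exponents `β` such that `x_J x^β` has degree at most `D` for all `J ⊆ I`. -/
def exponentSet (I : Finset (Fin n)) (D : ℤ) : Set (Fin n → ℤ) :=
  {β | ∀ J ⊆ I, weight (indicator J + β) ≤ D}

theorem degree_xProd_mul_le {I J : Finset (Fin n)} (hJ : J ⊆ I) {D : ℤ} {f : LaurentPoly n}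
    (hf : f ∈ supportedIn (exponentSet I D)) : degree (xProd J * f) ≤ (D : WithBot ℤ) :=
  degree_le_iff.2
    (single_mul_mem_supportedIn (S := exponentSet I D) (fun _ hβ => hβ J hJ) 1 hf)

theorem exponentSet_empty (D : ℤ) :
    exponentSet (∅ : Finset (Fin n)) D = {β | weight β ≤ D} := by
  ext β
  have : indicator (∅ : Finset (Fin n)) + β = β := by ext i; simp [indicator]
  simp [exponentSet, this]

/-! ### Passing to one variable less -/

/-- The inclusion of Laurent polynomials in the variables other than `x_k`. -/
noncomputable def extendAt (k : Fin (n + 1)) (f : LaurentPoly n) : LaurentPoly (n + 1) :=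
  AddMonoidAlgebra.mapDomain (fun β => (k.insertNth 0 β : Fin (n + 1) → ℤ)) f

theorem eval_extendAt (k : Fin (n + 1)) (x : Fin (n + 1) → ℂ) (f : LaurentPoly n) :
    eval x (extendAt k f) = eval (x ∘ k.succAbove) f := by
  induction f using AddMonoidAlgebra.induction_linear with
  | zero => simp [eval, extendAt]
  | add f g hf hg =>
    rw [extendAt] at hf hg ⊢
    rw [AddMonoidAlgebra.mapDomain_add, eval_add, eval_add, hf, hg]
  | single m r =>
    rw [extendAt, AddMonoidAlgebra.mapDomain_single, eval_single, eval_single]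
    simp [Fin.prod_univ_succAbove _ k]

theorem extendAt_mem_supportedIn (k : Fin (n + 1)) {S : Set (Fin n → ℤ)}
    {T : Set (Fin (n + 1) → ℤ)} (h : ∀ β ∈ S, (k.insertNth 0 β : Fin (n + 1) → ℤ) ∈ T)
    {f : LaurentPoly n} (hf : f ∈ supportedIn S) : extendAt k f ∈ supportedIn T := by
  classical
  refine mem_supportedIn.2 fun β hβ => ?_
  obtain ⟨β', hβ', rfl⟩ := Finset.mem_image.1 (Finsupp.mapDomain_support hβ)
  exact h _ (mem_supportedIn.1 hf _ hβ')

/-- The indices `i` with `k.succAbove i ∈ I`. -/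
def restrict (k : Fin (n + 1)) (I : Finset (Fin (n + 1))) : Finset (Fin n) :=
  Finset.univ.filter fun i => k.succAbove i ∈ I

theorem mem_restrict {k : Fin (n + 1)} {I : Finset (Fin (n + 1))} {i : Fin n} :
    i ∈ restrict k I ↔ k.succAbove i ∈ I := by
  simp [restrict]

theorem card_restrict {k : Fin (n + 1)} {I : Finset (Fin (n + 1))} (hk : k ∉ I) :
    (restrict k I).card = I.card := by
  rw [← Finset.card_map k.succAboveEmb]
  congr 1
  ext i
  simp only [Finset.mem_map, mem_restrict, Fin.succAboveEmb_apply]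
  constructor
  · rintro ⟨j, hj, rfl⟩
    exact hj
  · intro hi
    obtain ⟨j, rfl⟩ := Fin.exists_succAbove_eq (x := i) (y := k) (fun h => hk (h ▸ hi))
    exact ⟨j, hi, rfl⟩

theorem weight_indicator_add_insertNth_zero (k : Fin (n + 1)) (J : Finset (Fin (n + 1)))
    (β : Fin n → ℤ) :
    weight (indicator J + (k.insertNth 0 β : Fin (n + 1) → ℤ)) =
      (if k ∈ J then 1 else 0) + weight (indicator (restrict k J) + β) := by
  simp only [weight, Fin.sum_univ_succAbove _ k]
  congr 1
  · simp only [indicator, Pi.add_apply, Fin.insertNth_apply_same]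
    split_ifs <;> simp
  · simp [indicator, mem_restrict]

/-! ### The ordering of positions and the interpolation points -/

/-- Whether `i` precedes `j` in the ordering of positions defined by `α`, for `i < j`. -/
def Precedes (α : Fin n → ℤ) (i j : Fin n) : Prop :=
  |α j| < |α i| ∨ (0 ≤ α i ∧ (α i = α j ∨ α i = -α j))

theorem symm_sortPerm_lt_iff (α : Fin n → ℤ) {i j : Fin n} (hij : i < j) :
    (sortPerm α).symm i < (sortPerm α).symm j ↔ Precedes α i j :=
  (eq_sortPerm_iff α (sortPerm α)).1 rfl i j hij

theorem eq_symm_sortPerm {α : Fin n → ℤ} {ρ : Fin n → Fin n} (hρ : Function.Injective ρ)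
    (h : ∀ i j, i < j → (ρ i < ρ j ↔ Precedes α i j)) : ρ = (sortPerm α).symm := by
  have hb : Function.Bijective ρ := Finite.injective_iff_bijective.1 hρ
  have := (eq_sortPerm_iff α (Equiv.ofBijective ρ hb).symm).2 (by simpa [Precedes] using h)
  rw [← this]
  rfl

theorem symm_sortPerm_congr {α β : Fin n → ℤ}
    (h : ∀ i j, i < j → (Precedes α i j ↔ Precedes β i j)) :
    (sortPerm α).symm = (sortPerm β).symm := by
  apply Equiv.coe_inj.1
  exact eq_symm_sortPerm (Equiv.injective _) fun i j hij =>
    (symm_sortPerm_lt_iff α hij).trans (h i j hij)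

/-- The hypotheses say that `k` is sorted last. Deleting it does not affect comparisons between the
remaining positions, so these are ordered as in the shorter vector. -/
theorem symm_sortPerm_eq_insertNth {α : Fin (n + 1) → ℤ} {k : Fin (n + 1)}
    (h₁ : ∀ i < k, Precedes α i k) (h₂ : ∀ j, k < j → ¬ Precedes α k j) :
    ((sortPerm α).symm : Fin (n + 1) → Fin (n + 1)) =
      k.insertNth (Fin.last n) fun i => ((sortPerm (α ∘ k.succAbove)).symm i).castSucc := by
  symm
  apply eq_symm_sortPerm
  · intro i j hij
    rcases Fin.eq_self_or_eq_succAbove k i with hi | ⟨i, rfl⟩ <;>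
    rcases Fin.eq_self_or_eq_succAbove k j with hj | ⟨j, rfl⟩
    · rw [hi, hj]
    · simp only [hi, Fin.insertNth_apply_same, Fin.insertNth_apply_succAbove] at hij
      exact absurd hij.symm (Fin.castSucc_ne_last _)
    · simp [hj] at hij
    · simpa using hij
  · intro i j hij
    rcases Fin.eq_self_or_eq_succAbove k i with hi | ⟨i, rfl⟩ <;>
    rcases Fin.eq_self_or_eq_succAbove k j with hj | ⟨j, rfl⟩
    · exact absurd hij (by simp [hi, hj])
    · subst hi
      simpa [(Fin.le_last _).not_gt] using h₂ _ hij
    · subst hj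
      simpa [Fin.castSucc_lt_last] using h₁ _ hij
    · have := symm_sortPerm_lt_iff (α ∘ k.succAbove) (Fin.succAbove_lt_succAbove_iff.1 hij)
      simpa [Precedes] using this

theorem point_apply_of_last {α : Fin (n + 1) → ℤ} {k : Fin (n + 1)}
    (h₁ : ∀ i < k, Precedes α i k) (h₂ : ∀ j, k < j → ¬ Precedes α k j)
    (q : ℂ) (τ : Fin (n + 1) → ℂ) :
    point q τ α k = q ^ α k * τ (Fin.last n) ^ sgn (α k) ∧
      point q τ α ∘ k.succAbove = point q (τ ∘ Fin.castSucc) (α ∘ k.succAbove) := by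
  have h := symm_sortPerm_eq_insertNth h₁ h₂
  constructor
  · simp [point, h]
  · ext i
    simp [point, h]

theorem point_ne_zero {q : ℂ} (hq : 0 < ‖q‖) {τ : Fin n → ℂ} (hτ : τ ∈ paramSet n)
    (α : Fin n → ℤ) (i : Fin n) : point q τ α i ≠ 0 :=
  mul_ne_zero (zpow_ne_zero _ (norm_pos_iff.1 hq))
    (zpow_ne_zero _ (norm_pos_iff.1 (hτ.1 _)))

theorem comp_castSucc_mem_paramSet {τ : Fin (n + 1) → ℂ} (hτ : τ ∈ paramSet (n + 1)) :
    τ ∘ Fin.castSucc ∈ paramSet n :=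
  ⟨fun _ => hτ.1 _, fun _ _ h => hτ.2.1 _ _ (Fin.castSucc_lt_castSucc_iff.2 h), fun _ => hτ.2.2 _⟩

theorem smul_mem_paramSet {q : ℂ} (hq0 : 0 < ‖q‖) (hq1 : ‖q‖ < 1) {τ : Fin n → ℂ}
    (hτ : τ ∈ paramSet n) : q • τ ∈ paramSet n := by
  refine ⟨fun i => ?_, fun i j h => ?_, fun i => ?_⟩ <;>
    simp only [Pi.smul_apply, smul_eq_mul, norm_mul]
  · exact mul_pos hq0 (hτ.1 i)
  · exact mul_lt_mul_of_pos_left (hτ.2.1 i j h) hq0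
  · exact mul_lt_one_of_nonneg_of_lt_one_left hq0.le hq1 (hτ.2.2 i).le

theorem norm_le_norm_last {τ : Fin (n + 1) → ℂ} (hτ : τ ∈ paramSet (n + 1)) (i : Fin (n + 1)) :
    ‖τ i‖ ≤ ‖τ (Fin.last n)‖ := by
  rcases (Fin.le_last i).eq_or_lt with rfl | h
  · rfl
  · exact (hτ.2.1 _ _ h).le

/-- With `norm_inv_point_of_neg`, this keeps old points off the zero of the binomial, whichever `τ
i` the permutation selects, since `τₙ` has the largest norm. -/
theorem norm_point_lt_of_pos {q : ℂ} (hq0 : 0 < ‖q‖) (hq1 : ‖q‖ < 1) {τ : Fin (n + 1) → ℂ}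
    (hτ : τ ∈ paramSet (n + 1)) {α : Fin (n + 1) → ℤ} {k : Fin (n + 1)} (h : 0 < α k) :
    ‖point q τ α k‖ < ‖τ (Fin.last n)‖ := by
  obtain ⟨m, hm⟩ := Int.eq_ofNat_of_zero_le h.le
  have hm0 : m ≠ 0 := by omega
  rw [point, sgn, if_pos h.le, hm, zpow_one, norm_mul]
  simp only [zpow_natCast, norm_pow]
  calc _ ≤ ‖q‖ ^ m * ‖τ (Fin.last n)‖ := by gcongr; exact norm_le_norm_last hτ _
    _ < 1 * ‖τ (Fin.last n)‖ := by
      have := hτ.1 (Fin.last n)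
      have := pow_lt_one₀ hq0.le hq1 hm0
      gcongr
    _ = _ := one_mul _

theorem norm_inv_point_of_neg {q : ℂ} (hq0 : 0 < ‖q‖) (hq1 : ‖q‖ < 1) {τ : Fin (n + 1) → ℂ}
    (hτ : τ ∈ paramSet (n + 1)) {α : Fin (n + 1) → ℤ} {k : Fin (n + 1)} {m : ℕ}
    (h : α k < -m) : ‖(point q τ α k)⁻¹‖ < ‖q‖ ^ m * ‖τ (Fin.last n)‖ := by
  obtain ⟨l, hl⟩ := Int.eq_ofNat_of_zero_le (a := -α k) (by omega)
  have hα : α k = -(l : ℤ) := by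
    omega
  have hml : m < l := by omega
  rw [point, sgn, if_neg (by omega), hα, zpow_neg_one, zpow_neg, zpow_natCast, ← mul_inv, inv_inv,
    norm_mul, norm_pow]
  have := hτ.1 (Fin.last n)
  calc _ ≤ ‖q‖ ^ l * ‖τ (Fin.last n)‖ := by gcongr; exact norm_le_norm_last hτ _
    _ < ‖q‖ ^ m * ‖τ (Fin.last n)‖ :=
      mul_lt_mul_of_pos_right (pow_lt_pow_right_of_lt_one₀ hq0 hq1 hml) this

/-! ### Newton interpolation -/

/-- Arbitrary values at the points `ᾱ`, `α ∈ S`, are interpolated by Laurent polynomials with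
exponents in `E`. -/
def Interpolates (q : ℂ) (τ : Fin n → ℂ) (S E : Set (Fin n → ℤ)) : Prop :=
  ∀ v : (Fin n → ℤ) → ℂ, ∃ f ∈ supportedIn E, ∀ α ∈ S, eval (point q τ α) f = v α

theorem Interpolates.mono {q : ℂ} {τ : Fin n → ℂ} {S S' E E' : Set (Fin n → ℤ)}
    (h : Interpolates q τ S E) (hS : S' ⊆ S) (hE : E ⊆ E') : Interpolates q τ S' E' := by
  intro v
  obtain ⟨f, hf, hv⟩ := h v
  exact ⟨f, supportedIn_mono hE hf, fun α hα => hv α (hS hα)⟩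

theorem interpolates_of_isEmpty {q : ℂ} {τ : Fin n → ℂ} {S E : Set (Fin n → ℤ)}
    (h : ∀ α, α ∉ S) : Interpolates q τ S E :=
  fun _ => ⟨0, Submodule.zero_mem _, fun α hα => absurd hα (h α)⟩

theorem Interpolates.exists_eval_eq {q : ℂ} {τ : Fin n → ℂ} {S E : Set (Fin n → ℤ)}
    (h : Interpolates q τ S E) (v : S → ℂ) :
    ∃ f ∈ supportedIn E, ∀ α : S, eval (point q τ α) f = v α := by
  classical
  obtain ⟨f, hf, hv⟩ := h fun α => if hα : α ∈ S then v ⟨α, hα⟩ else 0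
  exact ⟨f, hf, fun α => by simp [hv α α.2]⟩

/-- The Newton-type step: points at which a binomial `x^u - c x^w` vanishes are handled in one
variable less, the other ones after division by the binomial. -/
theorem Interpolates.newton_step {q : ℂ} (hq : 0 < ‖q‖) {τ : Fin (n + 1) → ℂ}
    (hτ : τ ∈ paramSet (n + 1)) {k : Fin (n + 1)} {a : ℤ} {u w : Fin (n + 1) → ℤ} {c : ℂ}
    {S₀ E₀ : Set (Fin n → ℤ)} {S S' E E' : Set (Fin (n + 1) → ℤ)}
    (h₀ : Interpolates q (τ ∘ Fin.castSucc) S₀ E₀) (h : Interpolates q τ S E)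
    (hE₀ : ∀ β ∈ E₀, (k.insertNth 0 β : Fin (n + 1) → ℤ) ∈ E')
    (hu : ∀ β ∈ E, u + β ∈ E') (hw : ∀ β ∈ E, w + β ∈ E')
    (hS : ∀ α ∈ S', (α ∈ S ∧ ∏ i, point q τ α i ^ u i - c * ∏ i, point q τ α i ^ w i ≠ 0) ∨
      (α k = a ∧ α ∘ k.succAbove ∈ S₀ ∧
        point q τ α ∘ k.succAbove = point q (τ ∘ Fin.castSucc) (α ∘ k.succAbove) ∧
        ∏ i, point q τ α i ^ u i - c * ∏ i, point q τ α i ^ w i = 0)) :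
    Interpolates q τ S' E' := by
  intro v
  obtain ⟨g, hg, hgv⟩ := h₀ fun β => v (k.insertNth a β)
  -- The values asked of `f` are total; where the binomial vanishes the quotient is a junk value,
  -- harmless because `f` is multiplied by zero there.
  obtain ⟨f, hf, hfv⟩ := h fun α => (v α - eval (point q τ α) (extendAt k g)) /
    (∏ i, point q τ α i ^ u i - c * ∏ i, point q τ α i ^ w i)
  refine ⟨extendAt k g + (AddMonoidAlgebra.single u 1 * f - AddMonoidAlgebra.single w c * f),
    Submodule.add_mem _ (extendAt_mem_supportedIn k hE₀ hg)
      (Submodule.sub_mem _ (single_mul_mem_supportedIn hu 1 hf)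
        (single_mul_mem_supportedIn hw c hf)), fun α hα => ?_⟩
  have hx := point_ne_zero hq hτ α
  rw [eval_add, eval_sub, eval_single_mul hx, eval_single_mul hx, one_mul, ← sub_mul]
  rcases hS α hα with ⟨hαS, hne⟩ | ⟨hka, hαS, hp, hz⟩
  · rw [hfv α hαS, mul_div_cancel₀ _ hne, add_sub_cancel]
  · rw [hz, zero_mul, add_zero, eval_extendAt, hp, hgv _ hαS, ← hka]
    congr 1
    ext i
    rcases Fin.eq_self_or_eq_succAbove k i with rfl | ⟨i, rfl⟩ <;> simp

/-- `R(n,d,I)`, for an integer `d`. -/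
def nonzeroSet (d : ℤ) (I : Finset (Fin n)) : Set (Fin n → ℤ) :=
  {α | weight α ≤ d ∧ (∀ j, α j ≠ 0) ∧ ∀ i, i ∉ I → α i ≠ -1}

/-- `T(n,d,I)`, for an integer `d`. -/
def partlyNonzeroSet (d : ℤ) (I : Finset (Fin n)) : Set (Fin n → ℤ) :=
  {α | weight α ≤ d ∧ ∀ i, i ∉ I → α i ≠ 0}

theorem prod_zpow_single (x : Fin n → ℂ) (k : Fin n) (m : ℤ) :
    ∏ i, x i ^ (Pi.single k m : Fin n → ℤ) i = x k ^ m := by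
  rw [Finset.prod_eq_single k]
  · simp
  · intro i _ hi
    simp [hi]
  · simp

theorem indicator_insert {k : Fin n} {J : Finset (Fin n)} (hk : k ∉ J) :
    indicator (insert k J) = indicator J + Pi.single k 1 := by
  ext i
  by_cases hi : i = k
  · subst hi
    simp [indicator, hk]
  · simp [indicator, hi]

theorem indicator_of_mem {k : Fin n} {J : Finset (Fin n)} (hk : k ∈ J) :
    indicator J = indicator (J.erase k) + Pi.single k 1 := by
  conv_lhs => rw [← Finset.insert_erase hk]
  exact indicator_insert (Finset.notMem_erase k J)

theorem weight_add_single_le (β : Fin n → ℤ) (k : Fin n) (m : ℤ) :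
    weight (β + Pi.single k m) ≤ weight β + |m| := by
  have h : weight (Pi.single k m : Fin n → ℤ) = |m| := by
    rw [weight, Finset.sum_eq_single k] <;> simp +contextual
  rw [← h, weight, weight, weight, ← Finset.sum_add_distrib]
  exact Finset.sum_le_sum fun i _ => abs_add_le _ _

theorem weight_comp_succAbove (k : Fin (n + 1)) (α : Fin (n + 1) → ℤ) :
    weight α = |α k| + weight (α ∘ k.succAbove) := by
  simp [weight, Fin.sum_univ_succAbove _ k]

theorem restrict_subset_restrict {k : Fin (n + 1)} {I J : Finset (Fin (n + 1))}
    (h : J ⊆ insert k I) : restrict k J ⊆ restrict k I := by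
  intro i hi
  have := h (mem_restrict.1 hi)
  rw [Finset.mem_insert] at this
  exact mem_restrict.2 (this.resolve_left (Fin.succAbove_ne k i))

/-- The binomial is `1 - (q τₙ x_k)⁻¹`. When `α k = -1`, no earlier position holds `0` or `-1` since
`k` is below `I`, so `k` is sorted last and `x_k = (q τₙ)⁻¹`. The degree grows by one: if `k ∈ J`,
then `x_J` times the binomial is `x_{J \ k}` times `x_k - (q τₙ)⁻¹`. -/
theorem Interpolates.insert_min {q : ℂ} (hq0 : 0 < ‖q‖) (hq1 : ‖q‖ < 1) {τ : Fin (n + 1) → ℂ}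
    (hτ : τ ∈ paramSet (n + 1)) {k : Fin (n + 1)} {I : Finset (Fin (n + 1))} {d D : ℤ}
    (hk : ∀ i ∈ I, k < i)
    (h₀ : Interpolates q (τ ∘ Fin.castSucc) (nonzeroSet (d - 1) (restrict k I))
      (exponentSet (restrict k I) D))
    (h : Interpolates q τ (nonzeroSet d I) (exponentSet I D)) :
    Interpolates q τ (nonzeroSet d (insert k I)) (exponentSet (insert k I) (D + 1)) := by
  have hτl := hτ.1 (Fin.last n)
  have hkI : k ∉ I := fun hkI => lt_irrefl _ (hk k hkI)
  refine h₀.newton_step hq0 hτ (k := k) (a := -1) (u := 0) (w := Pi.single k (-1))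
    (c := (q * τ (Fin.last n))⁻¹) h ?_ ?_ ?_ ?_
  · intro β hβ J hJ
    rw [weight_indicator_add_insertNth_zero]
    have := hβ _ (restrict_subset_restrict hJ)
    split_ifs <;> omega
  · intro β hβ J hJ
    rw [zero_add]
    by_cases hkJ : k ∈ J
    · rw [indicator_of_mem hkJ, add_right_comm]
      have := hβ (J.erase k) (Finset.subset_insert_iff.1 hJ)
      have := weight_add_single_le (indicator (J.erase k) + β) k 1
      rw [abs_one] at this
      omega
    · have := hβ J ((Finset.subset_insert_iff_of_notMem hkJ).1 hJ)
      omega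
  · intro β hβ J hJ
    by_cases hkJ : k ∈ J
    · have := hβ (J.erase k) (Finset.subset_insert_iff.1 hJ)
      rw [indicator_of_mem hkJ, add_assoc, ← add_assoc (Pi.single k 1), ← Pi.single_add]
      simp only [add_neg_cancel, Pi.single_zero, zero_add]
      omega
    · have := hβ J ((Finset.subset_insert_iff_of_notMem hkJ).1 hJ)
      have := weight_add_single_le (indicator J + β) k (-1)
      rw [abs_neg, abs_one] at this
      rw [add_comm (Pi.single k (-1)) β, ← add_assoc]
      omega
  · rintro α ⟨hα, hα0, hα1⟩
    simp only [prod_zpow_single, Pi.zero_apply, zpow_zero, Finset.prod_const_one, zpow_neg_one]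
    by_cases hαk : α k = -1
    · right
      obtain ⟨hp, hp'⟩ := point_apply_of_last (α := α) (k := k)
        (fun i hi => by
          have h0 := hα0 i
          have h1 := hα1 i (by
            rw [Finset.mem_insert]
            rintro (rfl | hiI)
            · exact lt_irrefl _ hi
            · exact lt_asymm hi (hk i hiI))
          unfold Precedes
          grind)
        (fun j hj => by
          have h0 := hα0 j
          unfold Precedes
          grind) q τ
      refine ⟨hαk, ⟨?_, fun j => hα0 _, fun i hi => hα1 _ ?_⟩, hp', ?_⟩
      · rw [weight_comp_succAbove k, hαk] at hα
        simp at hα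
        omega
      · rw [mem_restrict] at hi
        simp [hi, Fin.succAbove_ne]
      · rw [hp, hαk]
        have h1 := norm_pos_iff.1 hq0
        have h2 := norm_pos_iff.1 hτl
        simp [sgn]
        field_simp
        simp
    · left
      refine ⟨⟨hα, hα0, fun i hi => ?_⟩, fun hz => ?_⟩
      · by_cases hik : i = k
        · exact hik ▸ hαk
        · exact hα1 i (by simp [hi, hik])
      · have h0 := hα0 k
        have hx := norm_pos_iff.2 (point_ne_zero hq0 hτ α k)
        have hz' : 1 = ‖q * τ (Fin.last n)‖⁻¹ * ‖point q τ α k‖⁻¹ := by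
          rw [← norm_inv, ← norm_inv, ← norm_mul, ← sub_eq_zero.1 hz, norm_one]
        rw [norm_mul] at hz'
        rcases lt_or_gt_of_ne h0 with h0 | h0
        · have := norm_inv_point_of_neg hq0 hq1 hτ (k := k) (m := 1) (α := α) (by grind)
          rw [norm_inv, pow_one] at this
          field_simp at hz' this
          linarith
        · have := norm_point_lt_of_pos hq0 hq1 hτ h0
          have h2 := hτ.2.2 (Fin.last n)
          field_simp at hz'
          have : ‖q‖ * ‖τ (Fin.last n)‖ < 1 := by nlinarith
          nlinarith

/-- The binomial is `x_k - τₙ`. When `α k = 0`, no later position holds `0` since `k` is above `I`,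
so `k` is sorted last and `x_k = τₙ`. The degree bound does not grow: `x_J x_k` is `x_{J ∪ k}`,
already controlled because `k ∉ I`. -/
theorem Interpolates.insert_max {q : ℂ} (hq0 : 0 < ‖q‖) (hq1 : ‖q‖ < 1) {τ : Fin (n + 1) → ℂ}
    (hτ : τ ∈ paramSet (n + 1)) {k : Fin (n + 1)} {I : Finset (Fin (n + 1))} {d : ℤ}
    (hk : ∀ i ∈ I, i < k)
    (h₀ : Interpolates q (τ ∘ Fin.castSucc) (partlyNonzeroSet d (restrict k I))
      (exponentSet (restrict k I)ᶜ d))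
    (h : Interpolates q τ (partlyNonzeroSet d I) (exponentSet Iᶜ d)) :
    Interpolates q τ (partlyNonzeroSet d (insert k I)) (exponentSet (insert k I)ᶜ d) := by
  have hτl := hτ.1 (Fin.last n)
  have hkI : k ∉ I := fun hkI => lt_irrefl _ (hk k hkI)
  have hsub : (insert k I)ᶜ ⊆ Iᶜ := Finset.compl_subset_compl.2 (Finset.subset_insert _ _)
  refine h₀.newton_step hq0 hτ (k := k) (a := 0) (u := Pi.single k 1) (w := 0)
    (c := τ (Fin.last n)) h ?_ ?_ ?_ ?_
  · intro β hβ J hJ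
    have hkJ : k ∉ J := fun hkJ => by simpa using hJ hkJ
    rw [weight_indicator_add_insertNth_zero, if_neg hkJ, zero_add]
    refine hβ _ fun i hi => ?_
    have := hsub (hJ (mem_restrict.1 hi))
    simpa [mem_restrict] using this
  · intro β hβ J hJ
    have hkJ : k ∉ J := fun hkJ => by simpa using hJ hkJ
    rw [← add_assoc, ← indicator_insert hkJ]
    exact hβ _ (Finset.insert_subset (by simpa using hkI) (hJ.trans hsub))
  · intro β hβ J hJ
    rw [zero_add]
    exact hβ J (hJ.trans hsub)
  · rintro α ⟨hα, hα0⟩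
    simp only [prod_zpow_single, Pi.zero_apply, zpow_zero, Finset.prod_const_one, zpow_one,
      mul_one]
    by_cases hαk : α k = 0
    · right
      obtain ⟨hp, hp'⟩ := point_apply_of_last (α := α) (k := k)
        (fun i hi => by
          unfold Precedes
          grind)
        (fun j hj => by
          have h0 := hα0 j (by
            rw [Finset.mem_insert]
            rintro (rfl | hjI)
            · exact lt_irrefl _ hj
            · exact lt_asymm hj (hk j hjI))
          unfold Precedes
          grind) q τ
      refine ⟨hαk, ⟨?_, fun i hi => hα0 _ ?_⟩, hp', ?_⟩
      · rw [weight_comp_succAbove k, hαk] at hα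
        simpa using hα
      · rw [mem_restrict] at hi
        simp [hi, Fin.succAbove_ne]
      · rw [hp, hαk]
        simp [sgn]
    · left
      refine ⟨⟨hα, fun i hi => ?_⟩, fun hz => ?_⟩
      · by_cases hik : i = k
        · exact hik ▸ hαk
        · exact hα0 i (by simp [hi, hik])
      · rw [sub_eq_zero] at hz
        rcases lt_or_gt_of_ne hαk with h0 | h0
        · have h1 := norm_inv_point_of_neg hq0 hq1 hτ (k := k) (m := 0) (α := α) (by simpa using h0)
          have h2 := hτ.2.2 (Fin.last n)
          rw [hz, norm_inv, pow_zero, one_mul] at h1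
          have := one_lt_inv₀ hτl |>.2 h2
          linarith
        · have := norm_point_lt_of_pos hq0 hq1 hτ h0
          rw [hz] at this
          exact lt_irrefl _ this

/-! ### Shifting the parameters by `q` -/

/-- The translation of `α` with all `α i ∉ {0, -1}` towards the origin. -/
def shrink (α : Fin n → ℤ) : Fin n → ℤ := fun i => α i - sgn (α i)

/-- The translation of `α` away from the origin. -/
def grow (α : Fin n → ℤ) : Fin n → ℤ := fun i => α i + sgn (α i)

/-- With `s = sgn (α i)`, `q ^ (α i - s) * (q τ) ^ s = q ^ α i * τ ^ s`. Excluding `0` and `-1`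
makes the shift preserve signs (`-1` would go to `0`, of sign `1`) and lower every absolute value by
one, hence preserve the ordering. -/
theorem Interpolates.of_smul {q : ℂ} (hq0 : 0 < ‖q‖) {τ : Fin n → ℂ} {d : ℤ}
    (h : Interpolates q (q • τ) {α | weight α ≤ d - n} (exponentSet ∅ (d - n))) :
    Interpolates q τ (nonzeroSet d ∅) (exponentSet ∅ (d - n)) := by
  intro v
  obtain ⟨f, hf, hv⟩ := h fun α => v (grow α)
  refine ⟨f, hf, fun α hα => ?_⟩
  obtain ⟨hα, hα0, hα1⟩ := hα
  replace hα1 : ∀ i, α i ≠ -1 := fun i => hα1 i (Finset.notMem_empty i)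
  have hsgn : ∀ i, sgn (shrink α i) = sgn (α i) := fun i => by
    have := hα0 i
    have := hα1 i
    unfold shrink sgn
    grind
  have habs : ∀ i, |shrink α i| = |α i| - 1 := fun i => by
    have := hα0 i
    have := hα1 i
    unfold shrink sgn
    grind
  have hgrow : grow (shrink α) = α := by
    ext i
    rw [grow, hsgn, shrink, sub_add_cancel]
  have hw : weight (shrink α) = weight α - n := by
    simp [weight, habs]
  have hprec : ∀ i j, i < j → (Precedes (shrink α) i j ↔ Precedes α i j) := fun i j _ => by
    have := hα0 i
    have := hα1 i
    have := hα0 j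
    have := hα1 j
    unfold Precedes
    simp only [habs]
    unfold shrink sgn
    grind
  have hp : point q (q • τ) (shrink α) = point q τ α := by
    ext i
    rw [point, point, symm_sortPerm_congr hprec, hsgn, Pi.smul_apply, smul_eq_mul, mul_zpow,
      ← mul_assoc, ← zpow_add₀ (norm_pos_iff.1 hq0), shrink, sub_add_cancel]
  have := hv (shrink α) (by rw [Set.mem_ofPred_eq, hw]; omega)
  rw [hp, hgrow] at this
  exact this

theorem interpolates_of_isEmpty_index {q : ℂ} {τ : Fin 0 → ℂ} {S E : Set (Fin 0 → ℤ)}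
    (h : ∀ α ∈ S, α ∈ E) : Interpolates q τ S E := by
  intro v
  by_cases h0 : (0 : Fin 0 → ℤ) ∈ S
  · refine ⟨AddMonoidAlgebra.single 0 (v 0), single_mem_supportedIn (h 0 h0) _, fun α _ => ?_⟩
    rw [eval_single, Subsingleton.elim α 0]
    simp
  · refine ⟨0, Submodule.zero_mem _, fun α hα => absurd ?_ h0⟩
    rwa [Subsingleton.elim 0 α]

/-! ### The simultaneous induction -/

theorem interpolates_nonzeroSet_and_partlyNonzeroSet {q : ℂ} (hq0 : 0 < ‖q‖) (hq1 : ‖q‖ < 1) :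
    ∀ (n : ℕ) (d : ℤ) (τ : Fin n → ℂ), τ ∈ paramSet n →
      (∀ I, Interpolates q τ (nonzeroSet d I) (exponentSet I (d - n + I.card))) ∧
        ∀ I, Interpolates q τ (partlyNonzeroSet d I) (exponentSet Iᶜ d) := by
  intro n
  induction n with
  | zero =>
    intro d τ _
    refine ⟨fun I => interpolates_of_isEmpty_index fun α hα J _ => ?_,
      fun I => interpolates_of_isEmpty_index fun α hα J _ => ?_⟩
    · rw [Subsingleton.elim (indicator J + α) α, Finset.eq_empty_of_isEmpty I]
      simpa using hα.1
    · rw [Subsingleton.elim (indicator J + α) α]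
      exact hα.1
  | succ n ihn =>
    -- Strong induction on `d`, an integer because `d - (n + 1)` may be negative (there are then no
    -- points), and for all `τ` because the recursive call uses `q • τ`.
    suffices ∀ (m : ℕ) (d : ℤ), d < m → ∀ (τ : Fin (n + 1) → ℂ), τ ∈ paramSet (n + 1) →
        (∀ I, Interpolates q τ (nonzeroSet d I) (exponentSet I (d - (n + 1 : ℕ) + I.card))) ∧
          ∀ I, Interpolates q τ (partlyNonzeroSet d I) (exponentSet Iᶜ d) from
      fun d => this (d.toNat + 1) d (by omega)
    intro m
    induction m with
    | zero =>
      intro d hd τ _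
      exact ⟨fun I => interpolates_of_isEmpty fun α hα => by
          have := weight_nonneg α
          have := hα.1
          omega,
        fun I => interpolates_of_isEmpty fun α hα => by
          have := weight_nonneg α
          have := hα.1
          omega⟩
    | succ m ihm =>
      intro d hd τ hτ
      have hR : ∀ I, Interpolates q τ (nonzeroSet d I)
          (exponentSet I (d - (n + 1 : ℕ) + I.card)) := by
        intro I
        induction I using Finset.induction_on_min with
        | empty =>
          have := (ihm (d - (n + 1 : ℕ)) (by omega) (q • τ) (smul_mem_paramSet hq0 hq1 hτ)).2
            Finset.univ
          rw [Finset.compl_univ] at this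
          rw [Finset.card_empty, Nat.cast_zero, add_zero]
          exact Interpolates.of_smul hq0
            (this.mono (fun α hα => ⟨hα, fun i hi => absurd (Finset.mem_univ i) hi⟩) subset_rfl)
        | insert k I hk ih =>
          have hkI : k ∉ I := fun hkI => lt_irrefl _ (hk k hkI)
          have h₀ := (ihn (d - 1) _ (comp_castSucc_mem_paramSet hτ)).1 (restrict k I)
          rw [card_restrict hkI, sub_sub, add_comm (1 : ℤ), ← Nat.cast_succ] at h₀
          rw [Finset.card_insert_of_notMem hkI, Nat.cast_succ I.card, ← add_assoc]
          exact Interpolates.insert_min hq0 hq1 hτ hk h₀ ih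
      refine ⟨hR, fun I => ?_⟩
      induction I using Finset.induction_on_max with
      | empty =>
        have := hR Finset.univ
        rw [Finset.card_univ, Fintype.card_fin, sub_add_cancel] at this
        rw [Finset.compl_empty]
        exact this.mono (fun α hα => ⟨hα.1, fun j => hα.2 j (Finset.notMem_empty j),
          fun i hi => absurd (Finset.mem_univ i) hi⟩) subset_rfl
      | insert k I hk ih =>
        exact Interpolates.insert_max hq0 hq1 hτ hk
          ((ihn d _ (comp_castSucc_mem_paramSet hτ)).2 (restrict k I)) ih

/-! ### Uniqueness -/

theorem finite_weight_le (d : ℤ) : {α : Fin n → ℤ | weight α ≤ d}.Finite :=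
  (Set.Finite.pi' fun _ : Fin n => Set.finite_Icc (-d) d).subset fun α hα i =>
    abs_le.1 ((abs_le_weight α i).trans hα)

/-- The same finite set `S` indexes the monomials and the points, so evaluation is in effect an
endomorphism of a finite-dimensional space, and surjectivity forces injectivity. -/
theorem eq_zero_of_eval_point_eq_zero {q : ℂ} {τ : Fin n → ℂ} {d : ℤ}
    (h : Interpolates q τ {α | weight α ≤ d} {α | weight α ≤ d}) {f : LaurentPoly n}
    (hf : f ∈ supportedIn {α : Fin n → ℤ | weight α ≤ d})
    (hf0 : ∀ α, weight α ≤ d → eval (point q τ α) f = 0) : f = 0 := by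
  set S : Set (Fin n → ℤ) := {α | weight α ≤ d} with hS
  have : Finite S := (finite_weight_le d).to_subtype
  let e : supportedIn S ≃ₗ[ℂ] (S →₀ ℂ) :=
    ((AddMonoidAlgebra.coeffLinearEquiv ℂ).ofSubmodule' (Finsupp.supported ℂ ℂ S)).trans
      (Finsupp.supportedEquivFinsupp S)
  let φ : supportedIn S →ₗ[ℂ] (S → ℂ) :=
    LinearMap.pi fun α => evalLinear (point q τ α) ∘ₗ (supportedIn S).subtype
  have hsurj : Function.Surjective
      (φ ∘ₗ (e.trans (Finsupp.linearEquivFunOnFinite ℂ ℂ S)).symm.toLinearMap) := by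
    rw [LinearMap.coe_comp]
    refine Function.Surjective.comp (fun v => ?_) (LinearEquiv.surjective _)
    obtain ⟨g, hg, hv⟩ := h.exists_eval_eq v
    exact ⟨⟨g, hg⟩, funext fun α => (evalLinear_apply _ _).trans (hv α)⟩
  have hinj := LinearMap.injective_iff_surjective.2 hsurj
  rw [LinearMap.coe_comp] at hinj
  have hinj' : Function.Injective φ := hinj.of_comp_right (LinearEquiv.surjective _)
  have : (⟨f, hf⟩ : supportedIn S) = 0 := hinj' <| by
    rw [map_zero]
    exact funext fun α => (evalLinear_apply _ _).trans (hf0 α α.2)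
  exact congrArg Subtype.val this

end LaurentInterp

theorem mainTheorem1 (n : ℕ) (hn : 0 < n) (q : ℂ) (hq0 : 0 < ‖q‖) (hq1 : ‖q‖ < 1)
    (τ : Fin n → ℂ) (hτ : τ ∈ LaurentInterp.paramSet n) (d : ℕ) :
    (∀ (I : Finset (Fin n)) (fbar : LaurentInterp.indexSetR n d I → ℂ),
      ∃ f : LaurentInterp.LaurentPoly n,
        (∀ α : LaurentInterp.indexSetR n d I,
          LaurentInterp.eval (LaurentInterp.point q τ α) f = fbar α) ∧
        ∀ J : Finset (Fin n), J ⊆ I →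
          LaurentInterp.degree (LaurentInterp.xProd J * f) ≤
            (((d : ℤ) - (n : ℤ) + (I.card : ℤ) : ℤ) : WithBot ℤ)) ∧
    (∀ (I : Finset (Fin n)) (fbar : LaurentInterp.indexSetT n d I → ℂ),
      ∃ f : LaurentInterp.LaurentPoly n,
        (∀ α : LaurentInterp.indexSetT n d I,
          LaurentInterp.eval (LaurentInterp.point q τ α) f = fbar α) ∧
        ∀ J : Finset (Fin n), J ⊆ Iᶜ →
          LaurentInterp.degree (LaurentInterp.xProd J * f) ≤ ((d : ℤ) : WithBot ℤ)) ∧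
    (∀ fbar : LaurentInterp.indexSet n d → ℂ,
      ∃! f : LaurentInterp.LaurentPoly n,
        LaurentInterp.degree f ≤ ((d : ℤ) : WithBot ℤ) ∧
        ∀ α : LaurentInterp.indexSet n d,
          LaurentInterp.eval (LaurentInterp.point q τ α) f = fbar α) ∧
    (∀ α : Fin n → ℤ,
      ∃! f : LaurentInterp.LaurentPoly n, LaurentInterp.IsNonsymmetricInterp q τ α f) := by
  open LaurentInterp in
  have key := fun d => interpolates_nonzeroSet_and_partlyNonzeroSet hq0 hq1 n d τ hτ
  have full : ∀ d : ℤ, Interpolates q τ {α | weight α ≤ d} {α | weight α ≤ d} := fun d => by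
    have := (key d).2 Finset.univ
    rw [Finset.compl_univ, exponentSet_empty] at this
    exact this.mono (fun α hα => ⟨hα, fun i hi => absurd (Finset.mem_univ i) hi⟩) subset_rfl
  have unique : ∀ (d : ℤ) (f g : LaurentPoly n), degree f ≤ (d : WithBot ℤ) →
      degree g ≤ (d : WithBot ℤ) →
      (∀ α, weight α ≤ d → eval (point q τ α) f = eval (point q τ α) g) → f = g := by
    intro d f g hf hg hfg
    refine sub_eq_zero.1 (eq_zero_of_eval_point_eq_zero (full d)
      (Submodule.sub_mem _ (degree_le_iff.1 hf) (degree_le_iff.1 hg)) fun α hα => ?_)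
    rw [eval_sub, hfg α hα, sub_self]
  refine ⟨fun I fbar => ?_, fun I fbar => ?_, fun fbar => ?_, fun α => ?_⟩
  · obtain ⟨f, hf, hv⟩ := ((key d).1 I).exists_eval_eq fbar
    exact ⟨f, hv, fun J hJ => degree_xProd_mul_le hJ hf⟩
  · obtain ⟨f, hf, hv⟩ := ((key d).2 I).exists_eval_eq fbar
    exact ⟨f, hv, fun J hJ => degree_xProd_mul_le hJ hf⟩
  · obtain ⟨f, hf, hv⟩ := (full d).exists_eval_eq fbar
    refine ⟨f, ⟨degree_le_iff.2 hf, hv⟩, fun g hg => ?_⟩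
    exact unique d g f hg.1 (degree_le_iff.2 hf) fun α hα =>
      (hg.2 ⟨α, hα⟩).trans (hv ⟨α, hα⟩).symm
  · obtain ⟨f, hf, hv⟩ := full (weight α) (Pi.single α 1)
    have hfα : IsNonsymmetricInterp q τ α f :=
      ⟨degree_le_iff.2 hf, by simpa using hv α (Set.mem_ofPred_eq ▸ le_rfl), fun β hβ hne => by
        simpa [hne] using hv β hβ⟩
    refine ⟨f, hfα, fun g hg => unique _ g f hg.1 hfα.1 fun β hβ => ?_⟩
    by_cases hne : β = α
    · rw [hne, hg.2.1, hfα.2.1]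
    · rw [hg.2.2 β hβ hne, hfα.2.2 β hβ hne]
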